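/- Fix an integer $p\ge 2$, a unit vector $\theta\in\mathcal S^{p-1}=\{x\in\mathbb R^p:\|x\|=1\}$ and $f\in\mathcal F$, where $\mathcal F$ is the class of monotone increasing functions $f:\mathbb R\to[0,\infty)$ that are twice differentiable at $0$ (that is, differentiable in a neighbourhood of $0$ with $f'$ differentiable at $0$) and satisfy $f(0)=f'(0)=1$. For $\kappa\in\mathbb R$, let $\mathrm P^{(n)}_{\theta,\kappa,f}$ be the joint law of a random sample $X_1,\dots,X_n$ from the probability density on $\mathcal S^{p-1}$, with respect to the surface area measure, that is proportional to $x\mapsto f(\kappa(x'\theta)^2)$, and let $\mathrm P^{(n)}_0$ be the joint law of a random sample of size $n$ from the uniform distribution over $\mathcal S^{p-1}$. Let $(\kappa_n)$ be a sequence of real numbers with $\kappa_n=O(1/\sqrt n)$ as $n\to\infty$. Then the sequences $\mathrm P^{(n)}_{\theta,\kappa_n,f}$ and $\mathrm P^{(n)}_0$ are mutually contiguous: for every sequence of measurable sets $A_n\subset(\mathcal S^{p-1})^n$, $$\mathrm P^{(n)}_0(A_n)\to 0\iff \mathrm P^{(n)}_{\theta,\kappa_n,f}(A_n)\to 0\qquad(n\to\infty).$$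 Consequently, no test is consistent at this rate: for any $\alpha<1$, there is no sequence of measurable (possibly randomized) tests $\phi_n:(\mathcal S^{p-1})^n\to[0,1]$ with asymptotic level $\alpha$, that is, $\limsup_{n\to\infty}\mathrm E_{\mathrm P^{(n)}_0}[\phi_n]\le\alpha$, and with power $\mathrm E_{\mathrm P^{(n)}_{\theta,\kappa_n,f}}[\phi_n]\to 1$. -/

import Mathlib

open MeasureTheory Filter Topology Asymptotics

noncomputable section

namespace AxialSphere

/-- The unit sphere `S^{p-1}` of the Euclidean space `ℝ^p`. -/
abbrev USphere (p : ℕ) : Type := Metric.sphere (0 : EuclideanSpace ℝ (Fin p)) 1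

/-- The surface area measure on `S^{p-1}`. -/
def surface (p : ℕ) : Measure (USphere p) :=
  (volume : Measure (EuclideanSpace ℝ (Fin p))).toSphere

/-- The class `𝓕` of functions `f : ℝ → [0, ∞)` that are monotone increasing and twice
differentiable at `0` (differentiable near `0`, with a derivative that is differentiable at `0`)
with `f 0 = f' 0 = 1`. -/
structure AngularClass (f : ℝ → ℝ) : Prop where
  nonneg : ∀ x, 0 ≤ f x
  monotone : Monotone f
  differentiable_near : ∀ᶠ x in 𝓝 (0 : ℝ), DifferentiableAt ℝ f x
  deriv_differentiableAt : DifferentiableAt ℝ (deriv f) 0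
  map_zero : f 0 = 1
  deriv_zero : deriv f 0 = 1

/-- The unnormalized density `x ↦ f (κ (x'θ)²)` on the sphere. -/
def axialWeight {p : ℕ} (θ : USphere p) (κ : ℝ) (f : ℝ → ℝ) (x : USphere p) : ℝ :=
  f (κ * (inner ℝ (x : EuclideanSpace ℝ (Fin p)) (θ : EuclideanSpace ℝ (Fin p))) ^ 2)

/-- The probability density on the sphere, with respect to the surface area measure, that is
proportional to `x ↦ f (κ (x'θ)²)`. -/
def axialDensity {p : ℕ} (θ : USphere p) (κ : ℝ) (f : ℝ → ℝ) (x : USphere p) : ℝ :=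
  (∫ y, axialWeight θ κ f y ∂(surface p))⁻¹ * axialWeight θ κ f x

/-- The axial rotationally symmetric distribution with location `θ`, concentration `κ` and
angular function `f`. -/
def axialLaw {p : ℕ} (θ : USphere p) (κ : ℝ) (f : ℝ → ℝ) : Measure (USphere p) :=
  (surface p).withDensity fun x => ENNReal.ofReal (axialDensity θ κ f x)

/-- The uniform distribution over the sphere. -/
def uniformLaw (p : ℕ) : Measure (USphere p) :=
  (surface p Set.univ)⁻¹ • surface p

/-- `P^{(n)}_{θ,κ,f}`: the joint law of a random sample of size `n` from `axialLaw θ κ f`. -/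
def altHyp {p : ℕ} (n : ℕ) (θ : USphere p) (κ : ℝ) (f : ℝ → ℝ) : Measure (Fin n → USphere p) :=
  Measure.pi fun _ => axialLaw θ κ f

/-- `P^{(n)}_0`: the joint law of a random sample of size `n` from the uniform distribution. -/
def nullHyp (p n : ℕ) : Measure (Fin n → USphere p) :=
  Measure.pi fun _ => uniformLaw p

/-- `(Q n)` is contiguous to `(P n)`: whenever events satisfy `P n (A n) → 0`, also
`Q n (A n) → 0`. -/
def Contiguous {Ω : ℕ → Type*} [∀ n, MeasurableSpace (Ω n)] (Q P : ∀ n, Measure (Ω n)) : Prop :=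
  ∀ A : ∀ n, Set (Ω n), (∀ n, MeasurableSet (A n)) →
    Tendsto (fun n => P n (A n)) atTop (𝓝 0) → Tendsto (fun n => Q n (A n)) atTop (𝓝 0)

/-- Mutual contiguity of two sequences of measures. -/
def MutuallyContiguous {Ω : ℕ → Type*} [∀ n, MeasurableSpace (Ω n)]
    (Q P : ∀ n, Measure (Ω n)) : Prop :=
  Contiguous Q P ∧ Contiguous P Q

/-- The sequence `φ` of (possibly randomized) tests has asymptotic level `α` for the sequence `P`
of null hypotheses, and is consistent against the sequence `Q` of alternatives: its power tends
to `1`. -/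
structure IsConsistentTest {Ω : ℕ → Type*} [∀ n, MeasurableSpace (Ω n)]
    (P Q : ∀ n, Measure (Ω n)) (α : ℝ) (φ : ∀ n, Ω n → ℝ) : Prop where
  measurable : ∀ n, Measurable (φ n)
  mem_Icc : ∀ n x, φ n x ∈ Set.Icc (0 : ℝ) 1
  level : limsup (fun n => ∫ x, φ n x ∂(P n)) atTop ≤ α
  power : Tendsto (fun n => ∫ x, φ n x ∂(Q n)) atTop (𝓝 1)

end AxialSphere

end

/-!
The proof bounds second moments of likelihood ratios, in both directions.

Let `μ` be the uniform law and `ν` the axial law with concentration `κ`. Since `f` is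
differentiable at `0` with `f 0 = 1`, the density `g` of `ν` with respect to `μ` satisfies
`|g - 1| ≤ C |κ|` uniformly on the sphere once `κ` is small, and so does the density `1 / g` of
`μ` with respect to `ν` (`densityNear_normalize`). A density with `∫ g ∂μ = 1` and `|g - 1| ≤ ε`
has `∫ g ^ 2 ∂μ = 1 + ∫ (g - 1) ^ 2 ∂μ ≤ 1 + ε ^ 2`: the first order term cancels. By independence
the likelihood ratio of samples of size `n` has second moment at most
`(1 + ε ^ 2) ^ n ≤ exp (n ε ^ 2)`, which stays bounded when `ε = O(1 / √n)`. The Cauchy–Schwarz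
inequality turns this into `(∫ h ∂νⁿ) ^ 2 ≤ C ∫ h ∂μⁿ` for all measurable `0 ≤ h ≤ 1`, and likewise
with `μ` and `ν` exchanged (`DensityNear.sq_lintegral_pi_le`).

Indicators `h` yield contiguity. Taking `h = 1 - φ` for a test `φ` shows that power tending to `1`
forces the level to tend to `1` as well, so no test of asymptotic level `α < 1` is consistent.
-/

open scoped ENNReal

namespace AxialSphere

/-! ### Second moments of likelihood ratios -/

/-- `ν` has a density with respect to `μ` that is uniformly within `ε` of `1`. The density is
real-valued, and enters `withDensity` through its positive part. -/
def DensityNear {X : Type*} [MeasurableSpace X] (ε : ℝ) (μ ν : Measure X) : Prop :=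
  ∃ g : X → ℝ, Measurable g ∧ (∀ x, |g x - 1| ≤ ε) ∧
    ν = μ.withDensity fun x => ENNReal.ofReal (g x)

section SecondMoment

variable {X : Type*} [MeasurableSpace X]

/-- The chi-square divergence of a density within `ε` of `1` is at most `ε ^ 2`. -/
lemma lintegral_sq_density_le {μ : Measure X} [IsProbabilityMeasure μ] {ε : ℝ}
    {g : X → ℝ} (hg : Measurable g) (hgε : ∀ x, |g x - 1| ≤ ε)
    (hg1 : ∫⁻ x, ENNReal.ofReal (g x) ∂μ = 1) :
    ∫⁻ x, ENNReal.ofReal (g x) ^ 2 ∂μ ≤ ENNReal.ofReal (1 + ε ^ 2) := by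
  -- Integrate `g ^ 2 + 1 ≤ 2 g + ε ^ 2`, which avoids subtraction in `ℝ≥0∞`.
  have key : ∀ x, ENNReal.ofReal (g x) ^ 2 + 1
      ≤ 2 * ENNReal.ofReal (g x) + ENNReal.ofReal (ε ^ 2) := by
    intro x
    have hsq : (g x - 1) ^ 2 ≤ ε ^ 2 := sq_le_sq' (abs_le.1 (hgε x)).1 (abs_le.1 (hgε x)).2
    rcases le_total 0 (g x) with h0 | h0
    · rw [← ENNReal.ofReal_pow h0, ← ENNReal.ofReal_one, ← ENNReal.ofReal_add (by positivity)
        zero_le_one, ← ENNReal.ofReal_ofNat 2, ← ENNReal.ofReal_mul (by norm_num),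
        ← ENNReal.ofReal_add (by positivity) (by positivity)]
      exact ENNReal.ofReal_le_ofReal (by nlinarith)
    · have h1 : (1 : ℝ≥0∞) ≤ ENNReal.ofReal (ε ^ 2) := ENNReal.one_le_ofReal.2 (by nlinarith)
      simpa only [ENNReal.ofReal_of_nonpos h0, zero_pow two_ne_zero, mul_zero, zero_add] using h1
  have hm := hg.ennreal_ofReal
  have hint := lintegral_mono (μ := μ) key
  rw [lintegral_add_right _ measurable_const, lintegral_add_right _ measurable_const,
    lintegral_const_mul _ hm, hg1] at hint
  simp only [lintegral_const, measure_univ, mul_one] at hint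
  rw [ENNReal.ofReal_add zero_le_one (by positivity), ENNReal.ofReal_one]
  refine (ENNReal.add_le_add_iff_right ENNReal.one_ne_top).1 (hint.trans_eq ?_)
  rw [← one_add_one_eq_two]
  ring

/-- Integrals of products of functions of the coordinates factorize under a power of `μ`. -/
lemma lintegral_pi_prod {μ : Measure X} [IsProbabilityMeasure μ] (n : ℕ)
    {g : Fin n → X → ℝ≥0∞} (hg : ∀ i, Measurable (g i)) :
    ∫⁻ x, ∏ i, g i (x i) ∂(Measure.pi fun _ : Fin n => μ) = ∏ i, ∫⁻ x, g i x ∂μ := by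
  have hind := ProbabilityTheory.iIndepFun_pi (μ := fun _ : Fin n => μ) (X := g)
    fun i => (hg i).aemeasurable
  rw [ProbabilityTheory.lintegral_prod_eq_prod_lintegral_of_indepFun Finset.univ _ hind
    fun i => (hg i).comp (measurable_pi_apply i)]
  exact Finset.prod_congr rfl fun i _ =>
    (measurePreserving_eval (fun _ : Fin n => μ) i).lintegral_comp (hg i)

/-- The likelihood ratio of a sample is the product of the likelihood ratios. -/
lemma pi_withDensity {μ : Measure X} [IsProbabilityMeasure μ] (n : ℕ) {g : X → ℝ≥0∞}
    (hg : Measurable g) [SigmaFinite (μ.withDensity g)] :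
    (Measure.pi fun _ : Fin n => μ.withDensity g)
      = (Measure.pi fun _ : Fin n => μ).withDensity fun x => ∏ i, g (x i) := by
  refine Measure.pi_eq fun s hs => ?_
  have hind : ∀ x : Fin n → X, (Set.univ.pi s).indicator (fun x => ∏ i, g (x i)) x
      = ∏ i, (s i).indicator g (x i) := by
    intro x
    by_cases hx : x ∈ Set.univ.pi s
    · rw [Set.indicator_of_mem hx]
      exact Finset.prod_congr rfl fun i _ => (Set.indicator_of_mem (hx i trivial) _).symm
    · rw [Set.indicator_of_notMem hx]
      obtain ⟨i, hi⟩ : ∃ i, x i ∉ s i := by simpa [Set.mem_pi] using hx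
      exact (Finset.prod_eq_zero (Finset.mem_univ i) (Set.indicator_of_notMem hi _)).symm
  have hms : MeasurableSet (Set.univ.pi s) := MeasurableSet.univ_pi hs
  rw [withDensity_apply _ hms, ← lintegral_indicator hms, lintegral_congr hind,
    lintegral_pi_prod n fun i => hg.indicator (hs i)]
  exact Finset.prod_congr rfl fun i _ => by
    rw [lintegral_indicator (hs i), withDensity_apply _ (hs i)]

lemma sq_lintegral_mul_le {μ : Measure X} {g h : X → ℝ≥0∞}
    (hg : Measurable g) (hh : Measurable h) :
    (∫⁻ x, g x * h x ∂μ) ^ 2 ≤ (∫⁻ x, g x ^ 2 ∂μ) * ∫⁻ x, h x ^ 2 ∂μ := by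
  have hCS := ENNReal.lintegral_mul_le_Lp_mul_Lq μ Real.HolderConjugate.two_two
    hg.aemeasurable hh.aemeasurable
  simp only [Pi.mul_apply, ENNReal.rpow_ofNat] at hCS
  refine (pow_le_pow_left' hCS 2).trans_eq ?_
  rw [mul_pow, ← ENNReal.rpow_natCast, ← ENNReal.rpow_natCast, ← ENNReal.rpow_mul,
    ← ENNReal.rpow_mul]
  norm_num

/-- If the law `ν` of one observation has a density within `ε` of `1` with respect to `μ`, then
expectations of functions `0 ≤ h ≤ 1` of a sample from `ν` are controlled by those under `μ`. -/
lemma DensityNear.sq_lintegral_pi_le {ε : ℝ} {μ ν : Measure X} [IsProbabilityMeasure μ]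
    [IsProbabilityMeasure ν] (H : DensityNear ε μ ν) (n : ℕ) {h : (Fin n → X) → ℝ≥0∞}
    (hh : Measurable h) (hh1 : ∀ x, h x ≤ 1) :
    (∫⁻ x, h x ∂(Measure.pi fun _ : Fin n => ν)) ^ 2
      ≤ ENNReal.ofReal (Real.exp (n * ε ^ 2)) * ∫⁻ x, h x ∂(Measure.pi fun _ : Fin n => μ) := by
  obtain ⟨g, hg, hgε, rfl⟩ := H
  have hG := hg.ennreal_ofReal
  have hg1 : ∫⁻ x, ENNReal.ofReal (g x) ∂μ = 1 := by
    have h1 := measure_univ (μ := μ.withDensity fun x => ENNReal.ofReal (g x))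
    rwa [withDensity_apply _ MeasurableSet.univ, Measure.restrict_univ] at h1
  have hprod : Measurable fun x : Fin n → X => ∏ i, ENNReal.ofReal (g (x i)) :=
    Finset.measurable_fun_prod _ fun i _ => hG.comp (measurable_pi_apply i)
  rw [pi_withDensity n hG, lintegral_withDensity_eq_lintegral_mul _ hprod hh]
  refine (sq_lintegral_mul_le hprod hh).trans (mul_le_mul' ?_ (lintegral_mono fun x => ?_))
  · simp_rw [← Finset.prod_pow]
    rw [lintegral_pi_prod n fun _ => hG.pow_const 2, Finset.prod_const, Finset.card_univ,
      Fintype.card_fin]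
    refine (pow_le_pow_left' (lintegral_sq_density_le hg hgε hg1) n).trans ?_
    rw [← ENNReal.ofReal_pow (by positivity), Real.exp_nat_mul]
    refine ENNReal.ofReal_le_ofReal (pow_le_pow_left₀ (by positivity) ?_ n)
    rw [add_comm]
    exact Real.add_one_le_exp _
  · rw [sq]
    exact mul_le_of_le_one_left' (hh1 x)

/-- Normalizing a weight within `ε` of `1` gives a probability density whose likelihood ratios to
and from the normalized base measure are within `4 ε` of `1`. -/
lemma densityNear_normalize {σ : Measure X} [IsFiniteMeasure σ] [NeZero σ] {w : X → ℝ}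
    (hw : Measurable w) {ε : ℝ} (hε : ε ≤ 1 / 2) (hwε : ∀ x, |w x - 1| ≤ ε) :
    IsProbabilityMeasure (σ.withDensity fun x => ENNReal.ofReal ((∫ y, w y ∂σ)⁻¹ * w x)) ∧
    DensityNear (4 * ε) ((σ Set.univ)⁻¹ • σ)
      (σ.withDensity fun x => ENNReal.ofReal ((∫ y, w y ∂σ)⁻¹ * w x)) ∧
    DensityNear (4 * ε) (σ.withDensity fun x => ENNReal.ofReal ((∫ y, w y ∂σ)⁻¹ * w x))
      ((σ Set.univ)⁻¹ • σ) := by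
  set c := ∫ y, w y ∂σ with hc
  set s := σ.real Set.univ with hs
  have hs0 : 0 < s := measureReal_univ_pos
  have hlow : ∀ x, 1 - ε ≤ w x := fun x => by linarith [(abs_le.1 (hwε x)).1]
  have hupp : ∀ x, w x ≤ 1 + ε := fun x => by linarith [(abs_le.1 (hwε x)).2]
  have hw0 : ∀ x, 0 < w x := fun x => by linarith [hlow x]
  have hint : Integrable w σ := Integrable.of_bound hw.aestronglyMeasurable (1 + ε)
    (ae_of_all _ fun x => by rw [Real.norm_of_nonneg (hw0 x).le]; exact hupp x)
  have hclow : (1 - ε) * s ≤ c := by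
    have := integral_mono (μ := σ) (integrable_const (1 - ε)) hint hlow
    rwa [integral_const, smul_eq_mul, mul_comm] at this
  have hcupp : c ≤ (1 + ε) * s := by
    have := integral_mono (μ := σ) hint (integrable_const (1 + ε)) hupp
    rwa [integral_const, smul_eq_mul, mul_comm] at this
  have hc0 : 0 < c := lt_of_lt_of_le (by nlinarith) hclow
  have hdiff : ∀ x, |s * w x - c| ≤ 2 * ε * s := fun x => by
    rw [abs_le]
    constructor <;> nlinarith [hlow x, hupp x]
  have hε0 : 0 ≤ ε := by
    obtain ⟨x⟩ : Nonempty X := by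
      by_contra hX
      rw [not_nonempty_iff] at hX
      exact NeZero.ne σ (Measure.eq_zero_of_isEmpty σ)
    exact (abs_nonneg _).trans (hwε x)
  have hνμ : (σ.withDensity fun x => ENNReal.ofReal (c⁻¹ * w x))
      = ((σ Set.univ)⁻¹ • σ).withDensity fun x => ENNReal.ofReal (s * (c⁻¹ * w x)) := by
    have hmul : (fun x => ENNReal.ofReal (s * (c⁻¹ * w x)))
        = σ Set.univ • fun x => ENNReal.ofReal (c⁻¹ * w x) := by
      funext x
      rw [ENNReal.ofReal_mul hs0.le, hs, ofReal_measureReal, Pi.smul_apply, smul_eq_mul]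
    rw [hmul, withDensity_smul' _ _ (measure_ne_top _ _), withDensity_smul_measure, smul_smul,
      ENNReal.mul_inv_cancel (NeZero.ne _) (measure_ne_top _ _), one_smul]
  have hg : Measurable fun x => s * (c⁻¹ * w x) := (hw.const_mul _).const_mul _
  refine ⟨⟨?_⟩, ⟨_, hg, fun x => ?_, hνμ⟩,
    ⟨fun x => (s * (c⁻¹ * w x))⁻¹, hg.inv, fun x => ?_, ?_⟩⟩
  · rw [withDensity_apply _ MeasurableSet.univ, Measure.restrict_univ,
      ← ofReal_integral_eq_lintegral_ofReal (hint.const_mul _)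
        (ae_of_all _ fun x => mul_nonneg (inv_nonneg.2 hc0.le) (hw0 x).le),
      integral_const_mul, ← hc, inv_mul_cancel₀ hc0.ne', ENNReal.ofReal_one]
  · have : s * (c⁻¹ * w x) - 1 = (s * w x - c) / c := by field_simp
    rw [this, abs_div, abs_of_pos hc0, div_le_iff₀ hc0]
    have h2 : s / 2 ≤ c := by nlinarith
    nlinarith [hdiff x]
  · have hx := hw0 x
    have : (s * (c⁻¹ * w x))⁻¹ - 1 = (c - s * w x) / (s * w x) := by field_simp
    rw [this, abs_div, abs_sub_comm, abs_of_pos (mul_pos hs0 hx), div_le_iff₀ (mul_pos hs0 hx)]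
    have h2 : s / 2 ≤ s * w x := by nlinarith [hlow x]
    nlinarith [hdiff x]
  · have hpos : ∀ x, 0 < s * (c⁻¹ * w x) := fun x =>
      mul_pos hs0 (mul_pos (inv_pos.2 hc0) (hw0 x))
    simp_rw [hνμ, ENNReal.ofReal_inv_of_pos (hpos _)]
    exact (withDensity_inv_same hg.ennreal_ofReal
      (ae_of_all _ fun x => (ENNReal.ofReal_pos.2 (hpos x)).ne')
      (ae_of_all _ fun x => ENNReal.ofReal_ne_top)).symm

end SecondMoment

/-! ### Contiguity and consistent tests -/

section Contiguity

variable {Ω : ℕ → Type*} [∀ n, MeasurableSpace (Ω n)] {P Q : ∀ n, Measure (Ω n)} {C : ℝ≥0∞}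

/-- Functional form of contiguity, deduced from a uniform quadratic bound. -/
lemma tendsto_lintegral_of_sq_le (hC : C ≠ ∞)
    (H : ∀ᶠ n in atTop, ∀ h : Ω n → ℝ≥0∞, Measurable h → (∀ x, h x ≤ 1) →
      (∫⁻ x, h x ∂(Q n)) ^ 2 ≤ C * ∫⁻ x, h x ∂(P n))
    {h : ∀ n, Ω n → ℝ≥0∞} (hh : ∀ n, Measurable (h n)) (hh1 : ∀ n x, h n x ≤ 1)
    (hP : Tendsto (fun n => ∫⁻ x, h n x ∂(P n)) atTop (𝓝 0)) :
    Tendsto (fun n => ∫⁻ x, h n x ∂(Q n)) atTop (𝓝 0) := by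
  have hsq : Tendsto (fun n => (∫⁻ x, h n x ∂(Q n)) ^ 2) atTop (𝓝 0) := by
    refine tendsto_of_tendsto_of_tendsto_of_le_of_le' tendsto_const_nhds
      (h := fun n => C * ∫⁻ x, h n x ∂(P n)) ?_ (Eventually.of_forall fun _ => zero_le) ?_
    · simpa using ENNReal.Tendsto.const_mul hP (Or.inr hC)
    · filter_upwards [H] with n hn using hn _ (hh n) (hh1 n)
  have hroot := hsq.ennrpow_const (1 / 2 : ℝ)
  rw [ENNReal.zero_rpow_of_pos (by norm_num)] at hroot
  refine hroot.congr fun n => ?_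
  rw [← ENNReal.rpow_natCast, ← ENNReal.rpow_mul]
  norm_num

lemma contiguous_of_sq_le (hC : C ≠ ∞)
    (H : ∀ᶠ n in atTop, ∀ h : Ω n → ℝ≥0∞, Measurable h → (∀ x, h x ≤ 1) →
      (∫⁻ x, h x ∂(Q n)) ^ 2 ≤ C * ∫⁻ x, h x ∂(P n)) : Contiguous Q P := by
  intro A hA hP
  have := tendsto_lintegral_of_sq_le hC H (h := fun n => (A n).indicator 1)
    (fun n => measurable_one.indicator (hA n))
    (fun n x => Set.indicator_le_self' (fun _ _ => zero_le) x)
  simp only [lintegral_indicator_one (hA _)] at this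
  exact this hP

lemma lintegral_ofReal_one_sub {X : Type*} [MeasurableSpace X] {μ : Measure X}
    [IsProbabilityMeasure μ] {φ : X → ℝ} (hφ : Measurable φ)
    (hφ01 : ∀ x, φ x ∈ Set.Icc (0 : ℝ) 1) :
    ∫⁻ x, ENNReal.ofReal (1 - φ x) ∂μ = ENNReal.ofReal (1 - ∫ x, φ x ∂μ) := by
  have hint : Integrable φ μ := Integrable.of_bound hφ.aestronglyMeasurable 1
    (ae_of_all _ fun x => by rw [Real.norm_of_nonneg (hφ01 x).1]; exact (hφ01 x).2)
  have hint' : Integrable (fun x => 1 - φ x) μ := (integrable_const 1).sub hint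
  rw [← ofReal_integral_eq_lintegral_ofReal hint'
    (ae_of_all _ fun x => sub_nonneg.2 (hφ01 x).2), integral_sub (integrable_const 1) hint]
  simp

/-- If expectations under `P` are quadratically controlled by those under `Q`, a test whose power
tends to `1` under `Q` also has rejection probability tending to `1` under `P`. -/
lemma not_isConsistentTest_of_sq_le (hC : C ≠ ∞)
    (hprob : ∀ᶠ n in atTop, IsProbabilityMeasure (P n) ∧ IsProbabilityMeasure (Q n))
    (H : ∀ᶠ n in atTop, ∀ h : Ω n → ℝ≥0∞, Measurable h → (∀ x, h x ≤ 1) →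
      (∫⁻ x, h x ∂(P n)) ^ 2 ≤ C * ∫⁻ x, h x ∂(Q n))
    {α : ℝ} (hα : α < 1) (φ : ∀ n, Ω n → ℝ) : ¬ IsConsistentTest P Q α φ := by
  intro hφ
  have hQ : Tendsto (fun n => ∫⁻ x, ENNReal.ofReal (1 - φ n x) ∂(Q n)) atTop (𝓝 0) := by
    have h1 : Tendsto (fun n => ENNReal.ofReal (1 - ∫ x, φ n x ∂(Q n))) atTop (𝓝 0) := by
      simpa using ENNReal.tendsto_ofReal (tendsto_const_nhds.sub hφ.power (a := (1 : ℝ)))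
    refine h1.congr' ?_
    filter_upwards [hprob] with n hn
    have := hn.2
    exact (lintegral_ofReal_one_sub (hφ.measurable n) (hφ.mem_Icc n)).symm
  have hP := tendsto_lintegral_of_sq_le hC H
    (fun n => ((hφ.measurable n).const_sub 1).ennreal_ofReal)
    (fun n x => ENNReal.ofReal_le_one.2 (by linarith [(hφ.mem_Icc n x).1])) hQ
  have hlim : Tendsto (fun n => ∫ x, φ n x ∂(P n)) atTop (𝓝 1) := by
    have h1 := (ENNReal.tendsto_toReal ENNReal.zero_ne_top).comp hP
    have h2 : Tendsto (fun n => 1 - (∫⁻ x, ENNReal.ofReal (1 - φ n x) ∂(P n)).toReal) atTop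
        (𝓝 1) := by simpa using tendsto_const_nhds.sub h1 (a := (1 : ℝ))
    refine h2.congr' ?_
    filter_upwards [hprob] with n hn
    have := hn.1
    have hle : ∫ x, φ n x ∂(P n) ≤ 1 := by
      refine (integral_mono_of_nonneg (ae_of_all _ fun x => (hφ.mem_Icc n x).1)
        (integrable_const 1) (ae_of_all _ fun x => (hφ.mem_Icc n x).2)).trans_eq ?_
      simp
    rw [lintegral_ofReal_one_sub (hφ.measurable n) (hφ.mem_Icc n),
      ENNReal.toReal_ofReal (sub_nonneg.2 hle), sub_sub_cancel]
  have hlevel := hφ.level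
  rw [hlim.limsup_eq] at hlevel
  linarith

end Contiguity

/-! ### The axial model -/

instance instIsFiniteMeasureSurface (p : ℕ) : IsFiniteMeasure (surface p) := by
  unfold surface
  infer_instance

lemma surface_ne_zero {p : ℕ} (hp : p ≠ 0) : surface p ≠ 0 := by
  have : NeZero p := ⟨hp⟩
  exact Measure.toSphere_ne_zero _

lemma AngularClass.exists_abs_sub_one_le {f : ℝ → ℝ} (hf : AngularClass f) :
    ∃ K : ℝ, 0 < K ∧ ∃ δ : ℝ, 0 < δ ∧ ∀ x, |x| < δ → |f x - 1| ≤ K * |x| := by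
  have hO := hf.differentiable_near.self_of_nhds.hasDerivAt.isBigO_sub
  obtain ⟨K, hK, hKO⟩ := hO.exists_pos
  obtain ⟨δ, hδ, hball⟩ := Metric.eventually_nhds_iff.1 hKO.bound
  refine ⟨K, hK, δ, hδ, fun x hx => ?_⟩
  simpa [hf.map_zero] using hball (y := x) (by simpa using hx)

lemma measurable_axialWeight {p : ℕ} (θ : USphere p) (κ : ℝ) {f : ℝ → ℝ} (hf : Measurable f) :
    Measurable (axialWeight θ κ f) :=
  hf.comp (by fun_prop)

lemma abs_mul_sq_inner_le {p : ℕ} (θ x : USphere p) (κ : ℝ) :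
    |κ * (inner ℝ (x : EuclideanSpace ℝ (Fin p)) (θ : EuclideanSpace ℝ (Fin p))) ^ 2| ≤ |κ| := by
  have h1 := abs_real_inner_le_norm (x : EuclideanSpace ℝ (Fin p)) (θ : EuclideanSpace ℝ (Fin p))
  rw [norm_eq_of_mem_sphere, norm_eq_of_mem_sphere, one_mul] at h1
  rw [abs_mul, abs_pow]
  exact mul_le_of_le_one_right (abs_nonneg _) (pow_le_one₀ (abs_nonneg _) h1)

/-- For all large `n`, the axial and uniform laws have mutual densities within `O(1 / √n)` of
`1`. -/
lemma exists_densityNear_axialLaw {p : ℕ} (hp : p ≠ 0) (θ : USphere p) {f : ℝ → ℝ}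
    (hf : AngularClass f) {κ : ℕ → ℝ}
    (hκ : κ =O[atTop] fun n : ℕ => 1 / Real.sqrt (n : ℝ)) :
    ∃ B : ℝ, ∀ᶠ n : ℕ in atTop, IsProbabilityMeasure (axialLaw θ (κ n) f) ∧
      ∃ ε : ℝ, n * ε ^ 2 ≤ B ∧ DensityNear ε (uniformLaw p) (axialLaw θ (κ n) f) ∧
        DensityNear ε (axialLaw θ (κ n) f) (uniformLaw p) := by
  obtain ⟨K, hK, δ, hδ, hfK⟩ := hf.exists_abs_sub_one_le
  obtain ⟨M, hM, hκM⟩ := hκ.exists_pos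
  have hκ0 : Tendsto (fun n => |κ n|) atTop (𝓝 0) := by
    have h0 : Tendsto (fun n : ℕ => 1 / Real.sqrt (n : ℝ)) atTop (𝓝 0) := by
      simp only [one_div]
      exact (Real.tendsto_sqrt_atTop.comp tendsto_natCast_atTop_atTop).inv_tendsto_atTop
    simpa using (hκ.trans_tendsto h0).abs
  have : NeZero (surface p) := ⟨surface_ne_zero hp⟩
  refine ⟨(4 * (K * M)) ^ 2, ?_⟩
  filter_upwards [hκM.bound, hκ0.eventually_lt_const hδ,
    hκ0.eventually_lt_const (show 0 < 1 / (2 * K) by positivity), eventually_gt_atTop 0]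
    with n hn hnδ hnK hn0
  have hε : K * |κ n| ≤ 1 / 2 := by
    rw [lt_div_iff₀ (by positivity)] at hnK
    linarith
  have hw : ∀ x, |axialWeight θ (κ n) f x - 1| ≤ K * |κ n| := fun x =>
    (hfK _ ((abs_mul_sq_inner_le θ x (κ n)).trans_lt hnδ)).trans
      (mul_le_mul_of_nonneg_left (abs_mul_sq_inner_le θ x (κ n)) hK.le)
  obtain ⟨h1, h2, h3⟩ := densityNear_normalize (σ := surface p)
    (measurable_axialWeight θ (κ n) hf.monotone.measurable) hε hw
  refine ⟨h1, 4 * (K * |κ n|), ?_, h2, h3⟩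
  have hsq : (n : ℝ) * |κ n| ^ 2 ≤ M ^ 2 := by
    have hn0' : (0 : ℝ) < n := by exact_mod_cast hn0
    have hle : |κ n| ≤ M / Real.sqrt n := by
      rw [Real.norm_eq_abs, Real.norm_of_nonneg (by positivity)] at hn
      rwa [mul_one_div] at hn
    have := pow_le_pow_left₀ (abs_nonneg _) hle 2
    rwa [div_pow, Real.sq_sqrt hn0'.le, le_div_iff₀ hn0', mul_comm] at this
  calc (n : ℝ) * (4 * (K * |κ n|)) ^ 2 = (4 * K) ^ 2 * (n * |κ n| ^ 2) := by ring
    _ ≤ (4 * K) ^ 2 * M ^ 2 := by gcongr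
    _ = (4 * (K * M)) ^ 2 := by ring

end AxialSphere

theorem mainTheorem1 (p : ℕ) (hp : 2 ≤ p) (θ : AxialSphere.USphere p) (f : ℝ → ℝ)
    (hf : AxialSphere.AngularClass f) (κ : ℕ → ℝ)
    (hκ : κ =O[atTop] fun n : ℕ => 1 / Real.sqrt (n : ℝ)) :
    AxialSphere.MutuallyContiguous
        (fun n => AxialSphere.altHyp n θ (κ n) f) (fun n => AxialSphere.nullHyp p n) ∧
      ∀ α : ℝ, α < 1 → ∀ φ : ∀ n : ℕ, (Fin n → AxialSphere.USphere p) → ℝ,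
        ¬ AxialSphere.IsConsistentTest
            (fun n => AxialSphere.nullHyp p n) (fun n => AxialSphere.altHyp n θ (κ n) f) α φ := by
  have hp0 : p ≠ 0 := by omega
  obtain ⟨B, hB⟩ := AxialSphere.exists_densityNear_axialLaw hp0 θ hf hκ
  have hσ : NeZero (AxialSphere.surface p) := ⟨AxialSphere.surface_ne_zero hp0⟩
  have hunif : IsProbabilityMeasure (AxialSphere.uniformLaw p) :=
    isProbabilityMeasureSMul
  have hexp : ∀ {n : ℕ} {ε : ℝ}, n * ε ^ 2 ≤ B →
      ENNReal.ofReal (Real.exp (n * ε ^ 2)) ≤ ENNReal.ofReal (Real.exp B) := fun h =>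
    ENNReal.ofReal_le_ofReal (Real.exp_le_exp.2 h)
  have hQP : ∀ᶠ n in atTop, ∀ h : (Fin n → AxialSphere.USphere p) → ℝ≥0∞, Measurable h →
      (∀ x, h x ≤ 1) → (∫⁻ x, h x ∂(AxialSphere.altHyp n θ (κ n) f)) ^ 2
        ≤ ENNReal.ofReal (Real.exp B) * ∫⁻ x, h x ∂(AxialSphere.nullHyp p n) := by
    filter_upwards [hB] with n ⟨_, ε, hε, hnear, _⟩ h hh hh1
    exact (hnear.sq_lintegral_pi_le n hh hh1).trans (mul_le_mul_left (hexp hε) _)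
  have hPQ : ∀ᶠ n in atTop, ∀ h : (Fin n → AxialSphere.USphere p) → ℝ≥0∞, Measurable h →
      (∀ x, h x ≤ 1) → (∫⁻ x, h x ∂(AxialSphere.nullHyp p n)) ^ 2
        ≤ ENNReal.ofReal (Real.exp B) * ∫⁻ x, h x ∂(AxialSphere.altHyp n θ (κ n) f) := by
    filter_upwards [hB] with n ⟨_, ε, hε, _, hnear⟩ h hh hh1
    exact (hnear.sq_lintegral_pi_le n hh hh1).trans (mul_le_mul_left (hexp hε) _)
  refine ⟨⟨AxialSphere.contiguous_of_sq_le ENNReal.ofReal_ne_top hQP,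
    AxialSphere.contiguous_of_sq_le ENNReal.ofReal_ne_top hPQ⟩, fun α hα φ =>
    AxialSphere.not_isConsistentTest_of_sq_le ENNReal.ofReal_ne_top ?_ hPQ hα φ⟩
  filter_upwards [hB] with n ⟨_, _⟩
  unfold AxialSphere.nullHyp AxialSphere.altHyp
  exact ⟨inferInstance, inferInstance⟩
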